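/- Let $\mathcal X\subseteq\mathbb R^d$ and let $k:\mathcal X\times\mathcal X\to\mathbb R$ be a continuous positive (semi)definite kernel with $k(x,x)=1$ for all $x$. Let $\mathcal H$ be its real reproducing kernel Hilbert space and $\phi(x)=k(\cdot,x)$ its feature map. For a Borel probability measure $p$ on $\mathcal X$ let $\Sigma_p=\int_{\mathcal X}\phi(x)\phi(x)^*\,dp(x)$ be its covariance operator on $\mathcal H$. For $\alpha\in(0,1)\cup(1,\infty)$ and $\lambda>0$ let $$D_{\alpha,\lambda}(\Sigma_p\|\Sigma_q)=\frac1{\alpha-1}\log\left(\frac{1}{\operatorname{tr}[\Sigma_p]}\operatorname{tr}\left[\left((\Sigma_q+\lambda\,\mathrm{Id})^{\frac{1-\alpha}{2\alpha}}\,\Sigma_p\,(\Sigma_q+\lambda\,\mathrm{Id})^{\frac{1-\alpha}{2\alpha}}\right)^{\alpha}\right]\right)\in[-\infty,\infty]$$ be the regularized kernel Rényi divergence (here $\operatorname{tr}[\Sigma_p]=1$). Let $\mathcal D$ be a set with an adjacency relation $\sim$, and let $f:\mathcal D\to\mathcal X$ be a randomized mechanism; $\mathcal L(f(D))$ denotes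 the law of $f(D)$. - $f$ is $(\varepsilon,\delta)$-differentially private if $\Pr[f(D)\in S]\le e^{\varepsilon}\Pr[f(D')\in S]+\delta$ for all $D\sim D'$ and all measurable $S\subseteq\mathcal X$. - $f$ satisfies $(k,\alpha,\lambda,\varepsilon)$-regularized kernel Rényi differential privacy if $D_{\alpha,\lambda}(\Sigma_{\mathcal L(f(D))}\|\Sigma_{\mathcal L(f(D'))})\le\varepsilon$ for all $D\sim D'$. **Proposition.** For every such kernel $k$, all $\varepsilon,\delta>0$ and all $\alpha\in[1/2,1)\cup(1,\infty)$, every $(\varepsilon,\delta)$-differentially private mechanism satisfies $(k,\alpha,\delta e^{-\varepsilon},\varepsilon)$-regularized kernel Rényi differential privacy. -/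

import Mathlib

open Polynomial MeasureTheory ProbabilityTheory
open scoped ENNReal NNReal InnerProductSpace

/-! ### Continuous functional calculus of self-adjoint operators on a real Hilbert space

Mathlib provides the continuous functional calculus for operators on complex Hilbert spaces. The
reproducing kernel Hilbert spaces below are real, so the corresponding instance is built here. -/

namespace RealCFC

variable {H : Type*} [NormedAddCommGroup H] [InnerProductSpace ℝ H] [CompleteSpace H]

lemma isSelfAdjoint_aeval {T : H →L[ℝ] H} (hT : IsSelfAdjoint T) (p : ℝ[X]) :
    IsSelfAdjoint (aeval T p) := by
  induction p using Polynomial.induction_on' with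
  | add p q hp hq => rw [map_add]; exact hp.add hq
  | monomial n a =>
    rw [aeval_monomial, ← Algebra.smul_def]
    exact (IsSelfAdjoint.all a).smul (hT.pow n)

lemma isUnit_quadratic {T : H →L[ℝ] H} (hT : IsSelfAdjoint T) {z : ℂ} (hz : z.im ≠ 0) :
    IsUnit (aeval T (X ^ 2 - C (2 * z.re) * X + C (‖z‖ ^ 2) : ℝ[X])) := by
  set S : H →L[ℝ] H := T - algebraMap ℝ (H →L[ℝ] H) z.re with hS
  have hSa : IsSelfAdjoint S := hT.sub (IsSelfAdjoint.algebraMap _ (IsSelfAdjoint.all z.re))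
  have hz2 : 0 < z.im ^ 2 := by positivity
  have hEq : aeval T (X ^ 2 - C (2 * z.re) * X + C (‖z‖ ^ 2) : ℝ[X])
      = S * S + algebraMap ℝ (H →L[ℝ] H) (z.im ^ 2) := by
    have hn : (X ^ 2 - C (2 * z.re) * X + C (‖z‖ ^ 2) : ℝ[X])
        = (X - C z.re) * (X - C z.re) + C (z.im ^ 2) := by
      rw [← Complex.normSq_eq_norm_sq, Complex.normSq_apply]
      simp only [map_add, map_mul, map_pow]
      have : (C 2 : ℝ[X]) = 2 := rfl
      rw [this]
      ring
    rw [hn]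
    simp only [map_add, map_mul, map_sub, aeval_X, aeval_C, hS]
  rw [hEq]
  refine ContinuousLinearMap.isUnit_of_forall_le_norm_inner_map _ (c := ⟨z.im ^ 2, hz2.le⟩) hz2 ?_
  intro x
  have h1 : ⟪(S * S + algebraMap ℝ (H →L[ℝ] H) (z.im ^ 2)) x, x⟫_ℝ
      = ‖S x‖ ^ 2 + z.im ^ 2 * ‖x‖ ^ 2 := by
    have h2 : ⟪S (S x), x⟫_ℝ = ‖S x‖ ^ 2 := by
      rw [← real_inner_self_eq_norm_sq]
      exact hSa.isSymmetric (S x) x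
    rw [Algebra.algebraMap_eq_smul_one, _root_.add_apply, inner_add_left]
    congr 1
    rw [_root_.smul_apply, one_apply_eq_self, real_inner_smul_left, real_inner_self_eq_norm_sq]
  rw [h1]
  refine le_trans ?_ (le_abs_self _)
  change ‖x‖ ^ 2 * z.im ^ 2 ≤ _
  nlinarith [sq_nonneg ‖S x‖]

lemma isUnit_aeval {T : H →L[ℝ] H} (hT : IsSelfAdjoint T) :
    ∀ (n : ℕ) (q : ℝ[X]), q.natDegree ≤ n → q ≠ 0 →
      (∀ t ∈ spectrum ℝ T, q.eval t ≠ 0) → IsUnit (aeval T q) := by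
  intro n
  induction n using Nat.strong_induction_on with
  | _ n ih =>
    intro q hqn hq0 hq
    by_cases hdeg : q.natDegree = 0
    · obtain ⟨c, rfl⟩ := natDegree_eq_zero.mp hdeg
      have hc : c ≠ 0 := fun h => hq0 (by simp [h])
      rw [aeval_C]
      exact (IsUnit.mk0 c hc).map _
    · have hpos : 0 < q.natDegree := Nat.pos_of_ne_zero hdeg
      have key : ∀ d r : ℝ[X], q = d * r → 0 < d.natDegree → IsUnit (aeval T d) →
          IsUnit (aeval T q) := by
        intro d r hdr hd hu
        have hd0 : d ≠ 0 := fun h => hq0 (by rw [hdr, h, zero_mul])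
        have hr0 : r ≠ 0 := fun h => hq0 (by rw [hdr, h, mul_zero])
        have hnd : q.natDegree = d.natDegree + r.natDegree := by
          rw [hdr, natDegree_mul hd0 hr0]
        have hr : IsUnit (aeval T r) := by
          refine ih r.natDegree (by omega) r le_rfl hr0 fun t ht h => hq t ht ?_
          rw [hdr, eval_mul, h, mul_zero]
        rw [hdr, map_mul]
        exact hu.mul hr
      obtain ⟨z, hz⟩ := IsAlgClosed.exists_aeval_eq_zero ℂ q
        (by rw [degree_eq_natDegree hq0]; exact_mod_cast hpos.ne')
      by_cases him : z.im = 0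
      · have hzr : q.eval z.re = 0 := by
          have h1 : z = algebraMap ℝ ℂ z.re := Complex.ext (by simp) (by simp [him])
          rw [h1, aeval_algebraMap_apply] at hz
          simpa [aeval_def] using hz
        obtain ⟨r, hr⟩ := dvd_iff_isRoot.mpr hzr
        refine key (X - C z.re) r hr (by simp) ?_
        have hns : z.re ∉ spectrum ℝ T := fun h => hq _ h hzr
        rw [spectrum.notMem_iff] at hns
        simpa using hns.neg
      · obtain ⟨r, hr⟩ := quadratic_dvd_of_aeval_eq_zero_im_ne_zero q hz him
        refine key _ r hr ?_ (isUnit_quadratic hT him)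
        have : (X ^ 2 - C (2 * z.re) * X + C (‖z‖ ^ 2) : ℝ[X]).natDegree = 2 := by
          compute_degree!
        omega

lemma spectrum_nonempty [Nontrivial H] {T : H →L[ℝ] H} (hT : IsSelfAdjoint T) :
    (spectrum ℝ T).Nonempty := by
  by_contra h
  rw [Set.not_nonempty_iff_eq_empty] at h
  have h1 := ContinuousLinearMap.spectralRadius_eq_nnnorm T hT
  have h2 : spectralRadius ℝ T = 0 := by simp [spectralRadius, h]
  have h3 : T = 0 := by simpa [h2] using h1.symm
  rw [h3, spectrum.zero_eq] at h
  exact Set.singleton_ne_empty _ h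

lemma exists_eval_eq_of_mem_spectrum {T : H →L[ℝ] H} (hT : IsSelfAdjoint T) {p : ℝ[X]} {r : ℝ}
    (hr : r ∈ spectrum ℝ (aeval T p)) : ∃ t ∈ spectrum ℝ T, p.eval t = r := by
  by_cases hq : p - C r = 0
  · have : Nontrivial H := by
      by_contra hn
      rw [not_nontrivial_iff_subsingleton] at hn
      rw [spectrum.of_subsingleton] at hr
      exact hr
    obtain ⟨t, ht⟩ := spectrum_nonempty hT
    exact ⟨t, ht, by rw [sub_eq_zero.mp hq, eval_C]⟩
  · by_contra! hne
    have hu := isUnit_aeval hT _ (p - C r) le_rfl hq fun t ht h => hne t ht <| by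
      rw [eval_sub, eval_C] at h
      linarith
    rw [map_sub, aeval_C] at hu
    exact hr ((spectrum.notMem_iff.mpr (by simpa using hu.neg)) |> fun h => absurd hr h)

lemma norm_aeval {T : H →L[ℝ] H} (hT : IsSelfAdjoint T) (p : ℝ[X]) :
    ‖aeval T p‖ = ‖p.toContinuousMapOn (spectrum ℝ T)‖ := by
  apply le_antisymm
  · have h1 := ContinuousLinearMap.spectralRadius_eq_nnnorm _ (isSelfAdjoint_aeval hT p)
    have h2 : spectralRadius ℝ (aeval T p) ≤ ‖p.toContinuousMapOn (spectrum ℝ T)‖₊ := by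
      refine iSup₂_le fun k hk => ?_
      obtain ⟨t, ht, rfl⟩ := exists_eval_eq_of_mem_spectrum hT hk
      exact_mod_cast (p.toContinuousMapOn (spectrum ℝ T)).norm_coe_le_norm ⟨t, ht⟩
    rw [h1] at h2
    exact_mod_cast h2
  · refine (ContinuousMap.norm_le _ (norm_nonneg _)).mpr fun t => ?_
    have : Nontrivial H := by
      by_contra hn
      rw [not_nontrivial_iff_subsingleton] at hn
      have hs : (t : ℝ) ∉ spectrum ℝ T := by simp [spectrum.of_subsingleton]
      exact hs t.2
    have ht : p.eval t.1 ∈ spectrum ℝ (aeval T p) :=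
      spectrum.subset_polynomial_aeval T p ⟨t.1, t.2, rfl⟩
    have h1 := le_iSup₂ (f := fun k (_ : k ∈ spectrum ℝ (aeval T p)) => (‖k‖₊ : ℝ≥0∞)) _ ht
    have h2 := h1.trans (spectrum.spectralRadius_le_nnnorm (𝕜 := ℝ) (aeval T p))
    exact_mod_cast h2

/-- Evaluation of polynomial functions on the spectrum, as a linear map into `C(spectrum ℝ T, ℝ)`. -/
noncomputable abbrev polyOn (T : H →L[ℝ] H) : ℝ[X] →ₐ[ℝ] C(spectrum ℝ T, ℝ) :=
  toContinuousMapOnAlgHom (spectrum ℝ T)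

lemma denseRange_polyOn (T : H →L[ℝ] H) : DenseRange (polyOn T) := by
  have h := polynomialFunctions.topologicalClosure (spectrum ℝ T)
  intro f
  have hf : f ∈ (polynomialFunctions (spectrum ℝ T)).topologicalClosure := h ▸ Algebra.mem_top
  rw [← SetLike.mem_coe, Subalgebra.topologicalClosure_coe, polynomialFunctions_coe] at hf
  exact hf

/-- The extension of `p ↦ p(T)` to all continuous functions on the spectrum of `T`. -/
noncomputable def extendPoly (T : H →L[ℝ] H) : C(spectrum ℝ T, ℝ) →L[ℝ] (H →L[ℝ] H) :=
  LinearMap.extendOfNorm (E := ℝ[X]) (Eₗ := C(spectrum ℝ T, ℝ)) (F := H →L[ℝ] H)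
    (aeval T : ℝ[X] →ₐ[ℝ] (H →L[ℝ] H)).toLinearMap (polyOn T).toLinearMap

lemma extendPoly_polyOn {T : H →L[ℝ] H} (hT : IsSelfAdjoint T) (p : ℝ[X]) :
    extendPoly T (polyOn T p) = aeval T p :=
  LinearMap.extendOfNorm_eq (denseRange_polyOn T)
    ⟨1, fun q => by rw [one_mul]; exact (norm_aeval hT q).le⟩ p

lemma extendPoly_mul {T : H →L[ℝ] H} (hT : IsSelfAdjoint T) (f g : C(spectrum ℝ T, ℝ)) :
    extendPoly T (f * g) = extendPoly T f * extendPoly T g := by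
  refine (denseRange_polyOn T).induction_on₂ (p := fun f g =>
    extendPoly T (f * g) = extendPoly T f * extendPoly T g) ?_ ?_ f g
  · exact isClosed_eq (by fun_prop) (by fun_prop)
  · intro p q
    rw [← map_mul, extendPoly_polyOn hT, extendPoly_polyOn hT, extendPoly_polyOn hT, map_mul]

lemma isSelfAdjoint_extendPoly {T : H →L[ℝ] H} (hT : IsSelfAdjoint T) (f : C(spectrum ℝ T, ℝ)) :
    IsSelfAdjoint (extendPoly T f) := by
  refine (denseRange_polyOn T).induction_on (p := fun f => IsSelfAdjoint (extendPoly T f)) f ?_ ?_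
  · exact isClosed_eq (by fun_prop) (by fun_prop)
  · intro p
    rw [extendPoly_polyOn hT]
    exact isSelfAdjoint_aeval hT p

lemma norm_extendPoly {T : H →L[ℝ] H} (hT : IsSelfAdjoint T) (f : C(spectrum ℝ T, ℝ)) :
    ‖extendPoly T f‖ = ‖f‖ := by
  refine (denseRange_polyOn T).induction_on (p := fun f => ‖extendPoly T f‖ = ‖f‖) f ?_ ?_
  · have hn : Continuous fun f : C(spectrum ℝ T, ℝ) => ‖f‖ :=
      continuous_norm (E := C(spectrum ℝ T, ℝ))
    exact isClosed_eq (extendPoly T).continuous.norm hn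
  · intro p
    rw [extendPoly_polyOn hT]
    exact norm_aeval hT p

/-- The functional calculus homomorphism `f ↦ f(T)` of a self-adjoint operator `T`. -/
noncomputable def hom {T : H →L[ℝ] H} (hT : IsSelfAdjoint T) :
    C(spectrum ℝ T, ℝ) →⋆ₐ[ℝ] (H →L[ℝ] H) where
  toFun := extendPoly T
  map_one' := by
    have h := extendPoly_polyOn hT 1
    rwa [map_one (polyOn T), map_one (aeval T)] at h
  map_mul' := extendPoly_mul hT
  map_zero' := map_zero _
  map_add' := map_add _
  commutes' r := by
    have h := extendPoly_polyOn hT (C r)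
    rwa [aeval_C, ← Polynomial.algebraMap_eq, AlgHom.commutes] at h
  map_star' f := by
    rw [show star f = f from ContinuousMap.ext fun _ => rfl]
    exact (isSelfAdjoint_extendPoly hT f).star_eq.symm

lemma isometry_hom {T : H →L[ℝ] H} (hT : IsSelfAdjoint T) : Isometry (hom hT) :=
  AddMonoidHomClass.isometry_of_norm (extendPoly T) (norm_extendPoly hT)

lemma hom_id {T : H →L[ℝ] H} (hT : IsSelfAdjoint T) :
    hom hT ((ContinuousMap.id ℝ).restrict (spectrum ℝ T)) = T := by
  have h : (ContinuousMap.id ℝ).restrict (spectrum ℝ T) = polyOn T X := by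
    ext t
    simp
  rw [h]
  exact (extendPoly_polyOn hT X).trans (aeval_X T)

lemma spectrum_hom {T : H →L[ℝ] H} (hT : IsSelfAdjoint T) (f : C(spectrum ℝ T, ℝ)) :
    spectrum ℝ (hom hT f) = Set.range f := by
  apply Set.Subset.antisymm
  · rw [← ContinuousMap.spectrum_eq_range]
    exact AlgHom.spectrum_apply_subset (hom hT) f
  · rintro _ ⟨t, rfl⟩
    have hcl : IsClosed {g : C(spectrum ℝ T, ℝ) | g t ∈ spectrum ℝ (hom hT g)} := by
      have : {g : C(spectrum ℝ T, ℝ) | g t ∈ spectrum ℝ (hom hT g)} =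
          (fun g : C(spectrum ℝ T, ℝ) => algebraMap ℝ (H →L[ℝ] H) (g t) - hom hT g) ⁻¹'
            nonunits (H →L[ℝ] H) := rfl
      rw [this]
      refine nonunits.isClosed.preimage (Continuous.sub ?_ (isometry_hom hT).continuous)
      exact (algebraMapCLM ℝ (H →L[ℝ] H)).continuous.comp (ContinuousEvalConst.continuous_eval_const t)
    refine (denseRange_polyOn T).induction_on (p := fun g => g t ∈ spectrum ℝ (hom hT g)) f hcl ?_
    intro p
    change p.eval t.1 ∈ spectrum ℝ (extendPoly T (polyOn T p))
    rw [extendPoly_polyOn hT]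
    exact spectrum.subset_polynomial_aeval T p ⟨t.1, t.2, rfl⟩

end RealCFC

/-- The continuous functional calculus of self-adjoint operators on a real Hilbert space. -/
instance instContinuousFunctionalCalculusReal {H : Type*} [NormedAddCommGroup H]
    [InnerProductSpace ℝ H] [CompleteSpace H] :
    ContinuousFunctionalCalculus ℝ (H →L[ℝ] H) IsSelfAdjoint where
  predicate_zero := IsSelfAdjoint.zero _
  spectrum_nonempty T hT := by
    have : Nontrivial H := by
      by_contra hn
      rw [not_nontrivial_iff_subsingleton] at hn
      exact not_subsingleton (H →L[ℝ] H) inferInstance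
    exact RealCFC.spectrum_nonempty hT
  exists_cfc_of_predicate T hT :=
    ⟨RealCFC.hom hT, (RealCFC.isometry_hom hT).continuous, (RealCFC.isometry_hom hT).injective,
      RealCFC.hom_id hT, RealCFC.spectrum_hom hT, RealCFC.isSelfAdjoint_extendPoly hT⟩

namespace KernelRenyi

section Operators

lemma ofReal_norm_sq {H ι : Type*} [NormedAddCommGroup H] [InnerProductSpace ℝ H]
    (b : HilbertBasis ι ℝ H) (x : H) :
    ENNReal.ofReal (‖x‖ ^ 2) = ∑' i, ENNReal.ofReal (⟪b i, x⟫_ℝ ^ 2) := by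
  have h := b.hasSum_inner_mul_inner x x
  have h2 : (fun i => ⟪x, b i⟫_ℝ * ⟪b i, x⟫_ℝ) = fun i => ⟪b i, x⟫_ℝ ^ 2 := by
    ext i
    rw [real_inner_comm x (b i), sq]
  rw [h2, real_inner_self_eq_norm_sq] at h
  rw [← h.tsum_eq, ENNReal.ofReal_tsum_of_nonneg (fun _ => sq_nonneg _) h.summable]

variable {H : Type*} [NormedAddCommGroup H] [InnerProductSpace ℝ H] [CompleteSpace H]

/-- The real power `T ^ s` of a self-adjoint operator, by continuous functional calculus. It is the
usual one if `T` is positive and `0 ≤ s`, or if `T` is positive and invertible and `s` is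
arbitrary. -/
noncomputable def opPow (T : H →L[ℝ] H) (s : ℝ) : H →L[ℝ] H :=
  cfc (fun x : ℝ => x ^ s) T

variable (H) in
/-- The index set of a fixed orthonormal basis of `H`. -/
noncomputable def basisIndex : Set H := (exists_hilbertBasis ℝ H).choose

variable (H) in
/-- A fixed orthonormal (Hilbert) basis of `H`. -/
noncomputable def basis : HilbertBasis (basisIndex H) ℝ H :=
  (exists_hilbertBasis ℝ H).choose_spec.choose

/-- The trace `∑ i, ⟪e i, T (e i)⟫`, in `[0, ∞]`, of a positive operator `T`. By
`trace_eq_tsum` it does not depend on the orthonormal basis. -/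
noncomputable def trace (T : H →L[ℝ] H) : ℝ≥0∞ :=
  ∑' i, ENNReal.ofReal ⟪basis H i, T (basis H i)⟫_ℝ

/-- The trace of a positive operator can be computed in any orthonormal basis. -/
lemma trace_eq_tsum {T : H →L[ℝ] H} (hT : T.IsPositive) {ι : Type*} (b : HilbertBasis ι ℝ H) :
    trace T = ∑' i, ENNReal.ofReal ⟪b i, T (b i)⟫_ℝ := by
  have hsp : ∀ x ∈ spectrum ℝ T, 0 ≤ x := fun x hx =>
    spectrum_nonneg_of_nonneg ((ContinuousLinearMap.nonneg_iff_isPositive T).mpr hT) hx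
  set S := cfc (fun x : ℝ => √x) T with hS
  have hSa : IsSelfAdjoint S := cfc_predicate _ _
  have hSS : S * S = T := by
    have h1 := cfc_mul (R := ℝ) (fun x : ℝ => √x) (fun x : ℝ => √x) T
    rw [← h1]
    conv_rhs => rw [← cfc_id' ℝ T hT.isSelfAdjoint]
    exact cfc_congr fun x hx => Real.mul_self_sqrt (hsp x hx)
  have hin : ∀ x, ⟪x, T x⟫_ℝ = ‖S x‖ ^ 2 := fun x => by
    rw [← hSS, ← real_inner_self_eq_norm_sq]
    exact (hSa.isSymmetric x (S x)).symm
  have hsym : ∀ x y, ⟪y, S x⟫_ℝ = ⟪x, S y⟫_ℝ := fun x y => by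
    rw [real_inner_comm]
    exact hSa.isSymmetric x y
  simp only [trace, hin]
  calc ∑' j, ENNReal.ofReal (‖S (basis H j)‖ ^ 2)
      = ∑' j, ∑' i, ENNReal.ofReal (⟪b i, S (basis H j)⟫_ℝ ^ 2) :=
        tsum_congr fun j => ofReal_norm_sq b _
    _ = ∑' i, ∑' j, ENNReal.ofReal (⟪b i, S (basis H j)⟫_ℝ ^ 2) := ENNReal.tsum_comm
    _ = ∑' i, ENNReal.ofReal (‖S (b i)‖ ^ 2) := tsum_congr fun i => by
        rw [ofReal_norm_sq (basis H)]
        exact tsum_congr fun j => by rw [hsym]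

/-- The order-`α` (sandwiched) quantum Rényi divergence
`D_α(A‖B) = (α - 1)⁻¹ log (tr[(B^((1-α)/(2α)) A B^((1-α)/(2α)))^α] / tr[A])`, with values in
`[-∞, ∞]`, for a positive nonzero trace-class operator `A` and a positive invertible operator `B`
(where no convention for negative powers of non-invertible operators is needed). -/
noncomputable def quantumRenyi (α : ℝ) (A B : H →L[ℝ] H) : EReal :=
  (((α - 1)⁻¹ : ℝ) : EReal) *
    ENNReal.log (trace (opPow (opPow B ((1 - α) / (2 * α)) * A * opPow B ((1 - α) / (2 * α))) α) /
      trace A)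

/-- The regularized quantum Rényi divergence `D_{α,lam}(A‖B) = D_α(A‖B + lam • Id)`, for `lam > 0`
and positive operators `A`, `B`. -/
noncomputable def regQuantumRenyi (α lam : ℝ) (A B : H →L[ℝ] H) : EReal :=
  quantumRenyi α A (B + lam • ContinuousLinearMap.id ℝ H)

end Operators

section Kernels

/-- The kernels considered: continuous, positive (semi)definite, and normalized on the diagonal. -/
structure IsNormalizedKernel {X : Type*} [TopologicalSpace X] (k : X → X → ℝ) : Prop where
  continuous : Continuous (Function.uncurry k)
  posSemidef : (Matrix.of k).PosSemidef
  diag_eq_one : ∀ x, k x x = 1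

variable {X : Type*} (H : Type*) [NormedAddCommGroup H] [InnerProductSpace ℝ H] [CompleteSpace H]
  [RKHS ℝ H X ℝ]

/-- `H`, a Hilbert space of real functions on `X` with continuous point evaluations, is the
reproducing kernel Hilbert space of the kernel `k`. -/
def HasKernel (k : X → X → ℝ) : Prop :=
  ∀ x y, RKHS.kernel H x y 1 = k x y

/-- The canonical feature map `φ x = k(·, x)`; it satisfies `f x = ⟪f, φ x⟫` for all `f : H`. -/
noncomputable def featureMap (x : X) : H := RKHS.kerFun H x 1

/-- The covariance operator `Σ_p = ∫ φ(x) φ(x)^* dp(x)`, a Bochner integral of operators. -/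
noncomputable def covariance [MeasurableSpace X] (p : Measure X) : H →L[ℝ] H :=
  ∫ x, InnerProductSpace.rankOne ℝ (featureMap H x) (featureMap H x) ∂p

/-- The regularized kernel Rényi divergence `D_{α,lam}(Σ_p‖Σ_q)`, for `lam > 0`. -/
noncomputable def regKernelRenyi [MeasurableSpace X] (α lam : ℝ) (p q : Measure X) : EReal :=
  regQuantumRenyi α lam (covariance H p) (covariance H q)

end Kernels

section Privacy

variable {X : Type*} [MeasurableSpace X] {𝒟 : Type*}

/-- `(ε, δ)`-differential privacy of a randomized mechanism, given by the law `law D` of its output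
on each input `D`, with respect to the adjacency relation `adj`. -/
def IsDP (ε δ : ℝ) (adj : 𝒟 → 𝒟 → Prop) (law : 𝒟 → ProbabilityMeasure X) : Prop :=
  ∀ D D', adj D D' → ∀ S : Set X, MeasurableSet S →
    (law D : Measure X).real S ≤ Real.exp ε * (law D' : Measure X).real S + δ

/-- `(k, α, lam, ε)`-regularized kernel Rényi differential privacy, for `lam > 0`, where `H` is the
reproducing kernel Hilbert space of `k`. -/
def IsRKRDP (H : Type*) [NormedAddCommGroup H] [InnerProductSpace ℝ H] [CompleteSpace H]
    [RKHS ℝ H X ℝ] (α lam ε : ℝ) (adj : 𝒟 → 𝒟 → Prop) (law : 𝒟 → ProbabilityMeasure X) : Prop :=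
  ∀ D D', adj D D' → regKernelRenyi H α lam (law D : Measure X) (law D' : Measure X) ≤ (ε : EReal)

end Privacy

end KernelRenyi

/-! ### Functional calculus: isometry and eigenvectors -/

namespace RealCFC

variable {H : Type*} [NormedAddCommGroup H] [InnerProductSpace ℝ H] [CompleteSpace H]

/-! Privacy enters only through an operator inequality. Slicing a function into level sets turns the
bound on events into `∫ u dp ≤ e^ε ∫ u dq + δ M` for measurable `0 ≤ u ≤ M`
(`integral_le_of_forall_real_le`). For `u x = ⟪f, φ x⟫²`, which is at most `‖f‖²`, this says `A ≤
e^ε B` with `A = Σ_p` and `B = Σ_q + δ e^(-ε) Id`: the regularization absorbs `δ` exactly.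

It remains to see that `A ≤ e^ε B` and `tr A = 1` force the divergence to be at most `ε`
(`quantumRenyi_le`). Put `t = |1 - α| / (2α)`; for `α > 0` it lies in `[0, 1/2]` precisely when `α ≥
1/2`. Then `K = A^t B^(-t)` satisfies `‖K‖² ≤ e^(2tε)` by Löwner-Heinz
(`norm_opPow_mul_opPow_neg_le`). Let `X` be the sandwiched operator. If `α > 1`, then `X = K^*
A^(1/α) K`; if `α < 1`, then `A^(1/α) = K X K^*`. In both cases `trace_opPow_conj_le` compares the
traces of the `α`-th powers and gives `tr X^α ≤ e^(ε(α-1))`, respectively `1 ≤ e^(ε(1-α)) tr X^α`.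
Taking logarithms and dividing by `α - 1`, whose sign matches the direction of the bound, gives `ε`
each time.

The trace comparison rests on Jensen's inequality. `A`, hence `X`, is compact, so both operators
have orthonormal eigenbases, and squared inner products link their eigenvalues through a matrix with
bounded row and column sums. -/

instance instIsometricContinuousFunctionalCalculusReal :
    IsometricContinuousFunctionalCalculus ℝ (H →L[ℝ] H) IsSelfAdjoint where
  isometric T hT := by
    rw [cfcHom_eq_of_continuous_of_map_id hT (hom hT) (isometry_hom hT).continuous (hom_id hT)]
    exact isometry_hom hT

/-- An eigenvector of `T` is an eigenvector of `f(T)`. -/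
lemma cfc_apply_eigenvector {T : H →L[ℝ] H} (hT : IsSelfAdjoint T) {f : ℝ → ℝ}
    (hf : ContinuousOn f (spectrum ℝ T)) {v : H} {μ : ℝ} (hv : T v = μ • v) :
    cfc f T v = f μ • v := by
  rcases eq_or_ne v 0 with rfl | hv0
  · simp
  have hμ : μ ∈ spectrum ℝ T := by
    rw [spectrum.mem_iff]
    intro hu
    obtain ⟨u, hu⟩ := hu
    apply hv0
    have h1 : (u : H →L[ℝ] H) v = 0 := by
      rw [hu]
      simp [Algebra.algebraMap_eq_smul_one, hv]
    have h2 : ((↑u⁻¹ : H →L[ℝ] H) * u) v = 0 := by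
      rw [mul_apply_eq_comp, h1, map_zero]
    simpa using h2
  rw [cfc_apply f T hT hf]
  -- The functions satisfying this form a closed subalgebra containing the identity, so
  -- Stone-Weierstrass gives all of them.
  suffices h : ∀ g : C(spectrum ℝ T, ℝ), cfcHom hT g v = g ⟨μ, hμ⟩ • v from h _
  intro g
  induction g using ContinuousMap.induction_on_of_compact with
  | const r =>
    have : (ContinuousMap.const (spectrum ℝ T) r) = algebraMap ℝ _ r := rfl
    rw [this, AlgHomClass.commutes]
    simp [Algebra.algebraMap_eq_smul_one]
  | id => rw [cfcHom_id hT, hv]; rfl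
  | star_id => rw [map_star, cfcHom_id hT, hT.star_eq, hv]; rfl
  | add f g hf hg => rw [map_add, _root_.add_apply, hf, hg, ContinuousMap.add_apply, add_smul]
  | mul f g hf hg =>
    rw [map_mul, mul_apply_eq_comp, hg, map_smul, hf, ContinuousMap.mul_apply, smul_smul,
      mul_comm]
  | frequently f hf =>
    have hcl : IsClosed {g : C(spectrum ℝ T, ℝ) | cfcHom hT g v = g ⟨μ, hμ⟩ • v} := by
      refine isClosed_eq ?_ ?_
      · exact (ContinuousLinearMap.apply ℝ H v).continuous.comp (cfcHom_continuous hT)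
      · exact (ContinuousEvalConst.continuous_eval_const _).smul continuous_const
    exact hcl.mem_of_frequently_of_tendsto hf Filter.tendsto_id

end RealCFC

namespace KernelRenyi

/-! ### Diagonalization of compact self-adjoint operators -/

section Eigenbasis

/-- A compact self-adjoint operator has an orthonormal basis of eigenvectors. -/
lemma exists_eigenbasis.{u} {H : Type u} [NormedAddCommGroup H] [InnerProductSpace ℝ H]
    [CompleteSpace H] {T : H →L[ℝ] H} (hc : IsCompactOperator T) (hT : IsSelfAdjoint T) :
    ∃ (ι : Type u) (b : HilbertBasis ι ℝ H) (μ : ι → ℝ), ∀ i, T (b i) = μ i • b i := by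
  let E : ℝ → Submodule ℝ H := fun μ => Module.End.eigenspace (T : Module.End ℝ H) μ
  have hE : ∀ μ, CompleteSpace (E μ) := fun μ => by
    have : IsClosed (E μ : Set H) := by
      have : (E μ : Set H) = {x | T x = μ • x} := by
        ext x
        exact Module.End.mem_eigenspace_iff
      rw [this]
      exact isClosed_eq T.continuous (continuous_const_smul μ)
    exact this.completeSpace_coe
  -- Every real `μ` is allowed; a trivial eigenspace contributes no vectors. Eigenspaces are
  -- mutually orthogonal, so the union of their bases is orthonormal.
  choose w b hb using fun μ => exists_hilbertBasis ℝ (E μ)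
  let v : (Σ μ, w μ) → H := fun i => ((b i.1 i.2 : E i.1) : H)
  have hv : Orthonormal ℝ v :=
    (hT.isSymmetric.orthogonalFamily_eigenspaces).orthonormal_sigma_orthonormal
      fun μ => (b μ).orthonormal
  have hsp : (Submodule.span ℝ (Set.range v))ᗮ = ⊥ := by
    rw [eq_bot_iff, ← ContinuousLinearMap.orthogonalComplement_iSup_eigenspaces_eq_bot hc
      hT.isSymmetric]
    intro x hx
    rw [← Submodule.iInf_orthogonal, Submodule.mem_iInf]
    intro μ
    rw [Submodule.mem_orthogonal]
    intro u hu
    -- Orthogonality to the basis of an eigenspace passes to its closed span, the whole eigenspace;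
    -- the spectral theorem then leaves no room for `x`.
    have hcl : (⟨u, hu⟩ : E μ) ∈ (Submodule.span ℝ (Set.range (b μ))).topologicalClosure := by
      rw [(b μ).dense_span]; trivial
    have hmap : ∀ y ∈ (Submodule.span ℝ (Set.range (b μ))).topologicalClosure,
        ⟪(y : H), x⟫_ℝ = 0 := by
      intro y hy
      have hclosed : IsClosed {y : E μ | ⟪(y : H), x⟫_ℝ = 0} :=
        isClosed_eq (by fun_prop) continuous_const
      refine closure_minimal (t := {y : E μ | ⟪(y : H), x⟫_ℝ = 0}) ?_ hclosed hy
      intro z hz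
      induction hz using Submodule.span_induction with
      | mem z hz =>
        obtain ⟨i, rfl⟩ := hz
        exact (Submodule.mem_orthogonal _ _).mp hx _ (Submodule.subset_span ⟨⟨μ, i⟩, rfl⟩)
      | zero => simp
      | add y z _ _ hy hz =>
        simp only [Set.mem_ofPred_eq] at hy hz ⊢
        rw [Submodule.coe_add, inner_add_left, hy, hz, add_zero]
      | smul a y _ hy =>
        simp only [Set.mem_ofPred_eq] at hy ⊢
        rw [Submodule.coe_smul, real_inner_smul_left, hy, mul_zero]
    exact hmap _ hcl
  refine ⟨_, HilbertBasis.mkOfOrthogonalEqBot hv hsp, fun i => i.1, fun i => ?_⟩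
  rw [HilbertBasis.coe_mkOfOrthogonalEqBot]
  exact Module.End.mem_eigenspace_iff.mp (b i.1 i.2).2

end Eigenbasis

/-! ### Real powers of positive operators -/

section Powers

variable {H : Type*} [NormedAddCommGroup H] [InnerProductSpace ℝ H] [CompleteSpace H]

lemma isSelfAdjoint_opPow (T : H →L[ℝ] H) (s : ℝ) : IsSelfAdjoint (opPow T s) :=
  cfc_predicate _ _

lemma spectrum_nonneg {T : H →L[ℝ] H} (hT : T.IsPositive) {x : ℝ} (hx : x ∈ spectrum ℝ T) :
    0 ≤ x :=
  spectrum_nonneg_of_nonneg ((ContinuousLinearMap.nonneg_iff_isPositive T).mpr hT) hx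

lemma le_of_mem_spectrum_add_smul {T : H →L[ℝ] H} (hT : T.IsPositive) {lam x : ℝ}
    (hx : x ∈ spectrum ℝ (T + lam • ContinuousLinearMap.id ℝ H)) : lam ≤ x := by
  have h : x - lam ∈ spectrum ℝ T := by
    rw [← spectrum.add_mem_add_iff (s := lam)]
    have e : algebraMap ℝ (H →L[ℝ] H) lam = lam • ContinuousLinearMap.id ℝ H := by
      rw [Algebra.algebraMap_eq_smul_one]; rfl
    rw [e, add_comm _ T]
    simpa using hx
  linarith [spectrum_nonneg hT h]

lemma continuousOn_rpow_of_nonneg (S : Set ℝ) {s : ℝ} (hs : 0 ≤ s) :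
    ContinuousOn (fun x : ℝ => x ^ s) S :=
  (Real.continuous_rpow_const hs).continuousOn

lemma continuousOn_rpow_of_pos {S : Set ℝ} (hS : ∀ x ∈ S, 0 < x) (s : ℝ) :
    ContinuousOn (fun x : ℝ => x ^ s) S :=
  continuousOn_id.rpow_const fun x hx => Or.inl (hS x hx).ne'

/-- The functional calculus supplies a self-adjoint square root `R`, and `R R^*` is positive. -/
lemma isPositive_of_isSelfAdjoint_of_spectrum_nonneg {T : H →L[ℝ] H} (hT : IsSelfAdjoint T)
    (h : ∀ x ∈ spectrum ℝ T, 0 ≤ x) : T.IsPositive := by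
  have hSS : cfc (fun x : ℝ => √x) T * cfc (fun x : ℝ => √x) T = T := by
    rw [← cfc_mul (R := ℝ) (fun x : ℝ => √x) (fun x : ℝ => √x) T]
    conv_rhs => rw [← cfc_id' ℝ T hT]
    exact cfc_congr fun x hx => Real.mul_self_sqrt (h x hx)
  have hSa : IsSelfAdjoint (cfc (fun x : ℝ => √x) T) := cfc_predicate _ _
  rw [← hSS]
  have := ContinuousLinearMap.isPositive_self_comp_adjoint (cfc (fun x : ℝ => √x) T)
  rwa [hSa.adjoint_eq] at this

lemma isPositive_opPow {T : H →L[ℝ] H} (hT : T.IsPositive) {s : ℝ} (hs : 0 ≤ s) :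
    (opPow T s).IsPositive := by
  refine isPositive_of_isSelfAdjoint_of_spectrum_nonneg (isSelfAdjoint_opPow T s) ?_
  intro x hx
  rw [opPow, cfc_map_spectrum (R := ℝ) (fun x : ℝ => x ^ s) T hT.isSelfAdjoint
    (continuousOn_rpow_of_nonneg _ hs)] at hx
  obtain ⟨y, hy, rfl⟩ := hx
  exact Real.rpow_nonneg (spectrum_nonneg hT hy) s

lemma opPow_mul_of_nonneg {T : H →L[ℝ] H} (hT : T.IsPositive) {s t : ℝ} (hs : 0 ≤ s)
    (ht : 0 ≤ t) : opPow T s * opPow T t = opPow T (s + t) := by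
  rw [opPow, opPow, ← cfc_mul _ _ T (continuousOn_rpow_of_nonneg _ hs)
    (continuousOn_rpow_of_nonneg _ ht)]
  exact cfc_congr fun x hx => (Real.rpow_add_of_nonneg (spectrum_nonneg hT hx) hs ht).symm

lemma opPow_mul_of_pos {T : H →L[ℝ] H} (hT : ∀ x ∈ spectrum ℝ T, 0 < x) (s t : ℝ) :
    opPow T s * opPow T t = opPow T (s + t) := by
  rw [opPow, opPow, ← cfc_mul _ _ T (continuousOn_rpow_of_pos hT s) (continuousOn_rpow_of_pos hT t)]
  exact cfc_congr fun x hx => (Real.rpow_add (hT x hx) s t).symm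

lemma opPow_zero {T : H →L[ℝ] H} (hT : IsSelfAdjoint T) : opPow T 0 = 1 := by
  simp only [opPow, Real.rpow_zero]
  exact cfc_const_one ℝ T

lemma opPow_one {T : H →L[ℝ] H} (hT : IsSelfAdjoint T) : opPow T 1 = T := by
  simp only [opPow, Real.rpow_one]
  exact cfc_id' ℝ T

lemma opPow_apply_eigenvector {T : H →L[ℝ] H} (hT : T.IsPositive) {s : ℝ} (hs : 0 ≤ s) {v : H}
    {μ : ℝ} (hv : T v = μ • v) : opPow T s v = μ ^ s • v :=
  RealCFC.cfc_apply_eigenvector hT.isSelfAdjoint (continuousOn_rpow_of_nonneg _ hs) hv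

lemma isPositive_conj {T : H →L[ℝ] H} (hT : T.IsPositive) {S : H →L[ℝ] H} (hS : IsSelfAdjoint S) :
    (S * T * S).IsPositive := by
  have := hT.conj_adjoint S
  rwa [hS.adjoint_eq] at this

end Powers

/-! ### The Löwner-Heinz inequality -/

section LoewnerHeinz

variable {H : Type*} [NormedAddCommGroup H] [InnerProductSpace ℝ H] [CompleteSpace H]

/-- A bounded midpoint-log-convex function on `[0, b]` that is at most `1` at the endpoints is at
most `1`. -/
lemma le_one_of_midpoint_sq_le {n : ℝ → ℝ} {b M : ℝ} (hn : ∀ t, 0 ≤ n t)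
    (hM : ∀ t ∈ Set.Icc 0 b, n t ≤ M) (h0 : n 0 ≤ 1) (hb : n b ≤ 1)
    (hmid : ∀ p ∈ Set.Icc 0 b, ∀ q ∈ Set.Icc 0 b, n ((p + q) / 2) ^ 2 ≤ n p * n q) :
    ∀ t ∈ Set.Icc 0 b, n t ≤ 1 := by
  intro t ht
  have hb0 : 0 ≤ b := ht.1.trans ht.2
  have hbd : BddAbove (n '' Set.Icc 0 b) := ⟨M, by rintro _ ⟨t, ht, rfl⟩; exact hM t ht⟩
  set S := sSup (n '' Set.Icc 0 b) with hS
  have hle : ∀ t ∈ Set.Icc 0 b, n t ≤ S := fun t ht => le_csSup hbd ⟨t, ht, rfl⟩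
  have hS0 : 0 ≤ S := (hn t).trans (hle t ht)
  -- `t` is the midpoint of its nearer endpoint and another point of the interval, so `n t ^ 2 ≤ 1 *
  -- S`. The supremum then satisfies `S ≤ √S`; no continuity of `n` is needed.
  have hsq : ∀ t ∈ Set.Icc 0 b, n t ≤ √S := by
    intro t ht
    apply Real.le_sqrt_of_sq_le
    rcases le_total t (b / 2) with h | h
    · have h1 := hmid 0 ⟨le_rfl, hb0⟩ (2 * t) ⟨by linarith [ht.1], by linarith⟩
      rw [show (0 + 2 * t) / 2 = t by ring] at h1
      calc n t ^ 2 ≤ n 0 * n (2 * t) := h1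
        _ ≤ 1 * S := mul_le_mul h0 (hle _ ⟨by linarith [ht.1], by linarith⟩) (hn _) zero_le_one
        _ = S := one_mul S
    · have h1 := hmid b ⟨hb0, le_rfl⟩ (2 * t - b) ⟨by linarith, by linarith [ht.2]⟩
      rw [show (b + (2 * t - b)) / 2 = t by ring] at h1
      calc n t ^ 2 ≤ n b * n (2 * t - b) := h1
        _ ≤ 1 * S := mul_le_mul hb (hle _ ⟨by linarith, by linarith [ht.2]⟩) (hn _) zero_le_one
        _ = S := one_mul S
  have h1 : S ≤ √S := csSup_le ⟨_, t, ht, rfl⟩ (by rintro _ ⟨t, ht, rfl⟩; exact hsq t ht)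
  have h2 : S ≤ 1 := by
    by_contra! h
    have h3 := Real.sq_sqrt hS0
    nlinarith [Real.sqrt_nonneg S]
  exact (hle t ht).trans h2

/-- The norm of a self-adjoint operator is its spectral radius, which is invariant under similarity
and never exceeds the norm. -/
lemma norm_le_of_conj_eq {M N : H →L[ℝ] H} (hM : IsSelfAdjoint M) (u : (H →L[ℝ] H)ˣ)
    (h : ↑u * M * ↑u⁻¹ = N) : ‖M‖ ≤ ‖N‖ := by
  rcases subsingleton_or_nontrivial H with hH | hH
  · simp [Subsingleton.elim M N]
  have h1 := ContinuousLinearMap.spectralRadius_eq_nnnorm M hM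
  have h2 := spectrum.spectralRadius_le_nnnorm (𝕜 := ℝ) N
  rw [spectralRadius, ← h, spectrum.units_conjugate] at h2
  rw [spectralRadius] at h1
  rw [h1, h] at h2
  exact_mod_cast h2

/-- The Löwner-Heinz inequality: if `A ≤ c B` with `A` positive and `B` positive and invertible,
then `‖A ^ t * B ^ (-t)‖ ≤ c ^ t` for `0 ≤ t ≤ 1/2`. -/
lemma norm_opPow_mul_opPow_neg_le {A B : H →L[ℝ] H} (hA : A.IsPositive) (hB : IsSelfAdjoint B)
    {lam c : ℝ} (hlam : 0 < lam) (hBs : ∀ x ∈ spectrum ℝ B, lam ≤ x) (hc : 0 < c)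
    (hAB : ∀ x, ⟪A x, x⟫_ℝ ≤ c * ⟪B x, x⟫_ℝ) {t : ℝ} (ht : t ∈ Set.Icc (0 : ℝ) (1 / 2)) :
    ‖opPow A t * opPow B (-t)‖ ≤ c ^ t := by
  have hBp : ∀ x ∈ spectrum ℝ B, 0 < x := fun x hx => hlam.trans_le (hBs x hx)
  set m : ℝ → ℝ := fun t => ‖opPow A t * opPow B (-t)‖ with hm
  -- Midpoint log-convexity of `m`: `m r ^ 2` is the norm of `B^(-r) A^(p+q) B^(-r)`, which is
  -- similar to `(B^(-p) A^p) (A^q B^(-q))`.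
  have hmul : ∀ p q : ℝ, 0 ≤ p → 0 ≤ q → m ((p + q) / 2) ^ 2 ≤ m p * m q := by
    intro p q hp hq
    set r := (p + q) / 2 with hr
    have hr0 : 0 ≤ r := by positivity
    have hstar : ∀ s, star (opPow A s * opPow B (-s)) = opPow B (-s) * opPow A s := fun s => by
      rw [star_mul, (isSelfAdjoint_opPow B (-s)).star_eq, (isSelfAdjoint_opPow A s).star_eq]
    have e1 : m r ^ 2 = ‖opPow B (-r) * opPow A (p + q) * opPow B (-r)‖ := by
      rw [sq, hm]
      simp only
      rw [← CStarRing.norm_star_mul_self, hstar, mul_assoc, ← mul_assoc (opPow A r),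
        opPow_mul_of_nonneg hA hr0 hr0, ← mul_assoc, hr, add_halves]
    have hsa : IsSelfAdjoint (opPow B (-r) * opPow A (p + q) * opPow B (-r)) := by
      rw [isSelfAdjoint_iff, star_mul, star_mul, (isSelfAdjoint_opPow B (-r)).star_eq,
        (isSelfAdjoint_opPow A _).star_eq, mul_assoc]
    -- Since `2 r = p + q`, conjugation by `B^(r-p)` changes the left exponent `-r` to `-p` and the
    -- right one to `-q`.
    let u : (H →L[ℝ] H)ˣ := ⟨opPow B (r - p), opPow B (p - r),
      by rw [opPow_mul_of_pos hBp, ← opPow_zero hB]; congr 1; ring,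
      by rw [opPow_mul_of_pos hBp, ← opPow_zero hB]; congr 1; ring⟩
    have e2 : ↑u * (opPow B (-r) * opPow A (p + q) * opPow B (-r)) * ↑u⁻¹
        = star (opPow A p * opPow B (-p)) * (opPow A q * opPow B (-q)) := by
      change opPow B (r - p) * (opPow B (-r) * opPow A (p + q) * opPow B (-r)) * opPow B (p - r) = _
      rw [hstar, ← opPow_mul_of_nonneg hA hp hq]
      calc _ = (opPow B (r - p) * opPow B (-r)) * (opPow A p * opPow A q) *
            (opPow B (-r) * opPow B (p - r)) := by simp only [mul_assoc]
        _ = opPow B (-p) * (opPow A p * opPow A q) * opPow B (-q) := by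
          rw [opPow_mul_of_pos hBp, opPow_mul_of_pos hBp]
          congr 3
          · ring_nf
          · rw [hr]; ring
        _ = _ := by simp only [mul_assoc]
    rw [e1]
    exact (norm_le_of_conj_eq hsa u e2).trans ((norm_mul_le _ _).trans
      (mul_le_mul_of_nonneg_right (LinearIsometryEquiv.norm_map ContinuousLinearMap.adjoint
        (opPow A p * opPow B (-p))).le (norm_nonneg _)))
  -- At exponent `1/2` the claim is the hypothesis `A ≤ c B` tested on `y = B^(-1/2) x`.
  have hhalf : m (1 / 2) ≤ c ^ (1 / 2 : ℝ) := by
    refine ContinuousLinearMap.opNorm_le_bound _ (by positivity) fun x => ?_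
    set y := opPow B (-(1 / 2)) x with hy
    have h1 : ‖opPow A (1 / 2) y‖ ^ 2 = ⟪A y, y⟫_ℝ := by
      rw [← real_inner_self_eq_norm_sq]
      have h := (isSelfAdjoint_opPow A (1 / 2)).isSymmetric (opPow A (1 / 2) y) y
      refine h.symm.trans ?_
      change ⟪(opPow A (1 / 2) * opPow A (1 / 2)) y, y⟫_ℝ = _
      rw [opPow_mul_of_nonneg hA (by norm_num) (by norm_num), add_halves,
        opPow_one hA.isSelfAdjoint]
    have h2 : ⟪B y, y⟫_ℝ = ‖x‖ ^ 2 := by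
      have h := (isSelfAdjoint_opPow B (-(1 / 2))).isSymmetric (B y) x
      refine h.symm.trans ?_
      have e : opPow B (-(1 / 2)) * (B * opPow B (-(1 / 2))) = 1 := by
        conv_lhs => enter [2, 1]; rw [← opPow_one hB]
        rw [opPow_mul_of_pos hBp, opPow_mul_of_pos hBp, ← opPow_zero hB]
        norm_num
      change ⟪(opPow B (-(1 / 2)) * (B * opPow B (-(1 / 2)))) x, x⟫_ℝ = _
      rw [e, one_apply_eq_self, real_inner_self_eq_norm_sq]
    have h3 : ‖opPow A (1 / 2) y‖ ^ 2 ≤ (c ^ (1 / 2 : ℝ) * ‖x‖) ^ 2 := by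
      rw [h1, mul_pow, ← Real.sqrt_eq_rpow, Real.sq_sqrt hc.le, ← h2]
      exact hAB y
    exact (sq_le_sq₀ (norm_nonneg _) (by positivity)).mp h3
  -- Any bound uniform in `t` will do; it only makes the supremum in `le_one_of_midpoint_sq_le`
  -- finite.
  have hbound : ∀ t ∈ Set.Icc (0 : ℝ) (1 / 2), m t / c ^ t ≤
      (max 1 ‖A‖ * max 1 lam⁻¹) * max 1 c⁻¹ := by
    have key : ∀ x ≥ (0 : ℝ), ∀ t ∈ Set.Icc (0 : ℝ) (1 / 2), x ^ t ≤ max 1 x := by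
      intro x hx t ht
      rcases le_total x 1 with h | h
      · exact (Real.rpow_le_one hx h ht.1).trans (le_max_left _ _)
      · refine le_trans ?_ (le_max_right _ _)
        conv_rhs => rw [← Real.rpow_one x]
        exact Real.rpow_le_rpow_of_exponent_le h (by linarith [ht.2])
    intro t ht
    rw [div_eq_mul_inv, ← Real.inv_rpow hc.le]
    refine mul_le_mul ((norm_mul_le _ _).trans (mul_le_mul ?_ ?_ (norm_nonneg _) (by positivity)))
      (key _ (by positivity) t ht) (by positivity) (by positivity)
    · refine norm_cfc_le (by positivity) fun x hx => ?_
      have hx0 := spectrum_nonneg hA hx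
      rw [Real.norm_of_nonneg (Real.rpow_nonneg hx0 _)]
      refine (key x hx0 t ht).trans (max_le_max le_rfl ?_)
      have : Nontrivial H := by
        by_contra hn
        rw [not_nontrivial_iff_subsingleton] at hn
        simp [spectrum.of_subsingleton] at hx
      exact (le_abs_self x).trans (spectrum.norm_le_norm_of_mem hx)
    · refine norm_cfc_le (by positivity) fun x hx => ?_
      have hx0 := hBp x hx
      rw [Real.norm_of_nonneg (Real.rpow_nonneg hx0.le _), Real.rpow_neg hx0.le,
        ← Real.inv_rpow hx0.le]
      refine (key _ (by positivity) t ht).trans (max_le_max le_rfl ?_)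
      exact inv_anti₀ hlam (hBs x hx)
  have hfin := le_one_of_midpoint_sq_le (n := fun t => m t / c ^ t) (fun t => by positivity) hbound
    ?_ ?_ ?_ t ht
  · simpa using (div_le_iff₀ (Real.rpow_pos_of_pos hc t)).mp hfin
  · simp only [hm, neg_zero, opPow_zero hA.isSelfAdjoint, opPow_zero hB, mul_one, Real.rpow_zero,
      div_one]
    exact ContinuousLinearMap.norm_id_le
  · exact (div_le_one (by positivity)).mpr hhalf
  · intro p hp q hq
    have h := hmul p q hp.1 hq.1
    have e : (c ^ ((p + q) / 2)) ^ 2 = c ^ (p + q) := by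
      rw [← Real.rpow_natCast, ← Real.rpow_mul hc.le]
      congr 1
      push_cast
      ring
    rw [div_pow, div_mul_div_comm, ← Real.rpow_add hc, e]
    gcongr

end LoewnerHeinz

/-! ### Jensen inequalities for infinite weighted sums -/

section Jensen

variable {ι κ : Type*}

/-- Weighted Hölder on finite sums, then a supremum; the total mass `c` need not be `1`, which costs
the factor `c ^ (p - 1)`. -/
lemma tsum_mul_rpow_le {w f : ι → ℝ≥0∞} {c : ℝ≥0∞} {p : ℝ} (hp : 1 ≤ p) (hw : ∑' i, w i ≤ c) :
    (∑' i, w i * f i) ^ p ≤ c ^ (p - 1) * ∑' i, w i * f i ^ p := by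
  have hp0 : 0 < p := by linarith
  have hp1 : 0 ≤ 1 - p⁻¹ := by
    have := inv_le_one_of_one_le₀ hp
    linarith
  have h : ∑' i, w i * f i ≤ c ^ (1 - p⁻¹) * (∑' i, w i * f i ^ p) ^ p⁻¹ := by
    rw [ENNReal.tsum_eq_iSup_sum]
    refine iSup_le fun s => (ENNReal.inner_le_weight_mul_Lp_of_nonneg s hp w f).trans ?_
    gcongr
    · exact (ENNReal.sum_le_tsum s).trans hw
    · exact ENNReal.sum_le_tsum s
  calc (∑' i, w i * f i) ^ p
      ≤ (c ^ (1 - p⁻¹) * (∑' i, w i * f i ^ p) ^ p⁻¹) ^ p := ENNReal.rpow_le_rpow h hp0.le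
    _ = c ^ (p - 1) * ∑' i, w i * f i ^ p := by
      rw [ENNReal.mul_rpow_of_nonneg _ _ hp0.le, ← ENNReal.rpow_mul, ← ENNReal.rpow_mul,
        inv_mul_cancel₀ hp0.ne', ENNReal.rpow_one, sub_mul, one_mul, inv_mul_cancel₀ hp0.ne']

lemma tsum_mul_rpow_le_of_le_one {w f : ι → ℝ≥0∞} {p : ℝ} (hp0 : 0 < p) (hp : p ≤ 1)
    (hw : ∑' i, w i ≤ 1) : ∑' i, w i * f i ^ p ≤ (∑' i, w i * f i) ^ p := by
  -- The concave case is the convex one for exponent `1/p` applied to `f ^ p`.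
  have h := tsum_mul_rpow_le (f := fun i => f i ^ p) ((one_le_inv₀ hp0).mpr hp) hw
  simp only [← ENNReal.rpow_mul, mul_inv_cancel₀ hp0.ne', ENNReal.rpow_one, ENNReal.one_rpow,
    one_mul] at h
  have h2 := ENNReal.rpow_le_rpow h hp0.le
  rwa [← ENNReal.rpow_mul, inv_mul_cancel₀ hp0.ne', ENNReal.rpow_one] at h2

/-- Column sums at most `c` allow Jensen for each `j`, giving `c ^ (a - 1)`; after exchanging the
sums, the row sums give the last factor `c`. -/
lemma tsum_rpow_le_of_one_le {q : ι → κ → ℝ≥0∞} {ξ : ι → ℝ≥0∞} {ν : κ → ℝ≥0∞} {c : ℝ≥0∞} {a : ℝ}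
    (ha : 1 ≤ a) (hν : ∀ j, ν j = ∑' i, q i j * ξ i) (h1 : ∀ j, ∑' i, q i j ≤ c)
    (h2 : ∀ i, ∑' j, q i j ≤ c) : ∑' j, ν j ^ a ≤ c ^ a * ∑' i, ξ i ^ a :=
  calc ∑' j, ν j ^ a ≤ ∑' j, c ^ (a - 1) * ∑' i, q i j * ξ i ^ a :=
        ENNReal.tsum_le_tsum fun j => by rw [hν]; exact tsum_mul_rpow_le ha (h1 j)
    _ = c ^ (a - 1) * ∑' i, (∑' j, q i j) * ξ i ^ a := by
        rw [ENNReal.tsum_mul_left, ENNReal.tsum_comm]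
        simp only [ENNReal.tsum_mul_right]
    _ ≤ c ^ (a - 1) * ∑' i, c * ξ i ^ a := by
        gcongr with i
        exact h2 i
    _ = c ^ a * ∑' i, ξ i ^ a := by
        rw [ENNReal.tsum_mul_left, ← mul_assoc]
        congr 1
        conv_lhs => enter [2]; rw [← ENNReal.rpow_one c]
        rw [← ENNReal.rpow_add_of_nonneg _ _ (by linarith) zero_le_one, sub_add_cancel]

/-- For concave powers Jensen runs the other way: each `ν j ^ a` is spread over `i` with total
weight exactly `1`, and Jensen is applied in `j` for fixed `i`. -/
lemma tsum_rpow_le_of_le_one {r : ι → κ → ℝ≥0∞} {ξ : ι → ℝ≥0∞} {ν : κ → ℝ≥0∞} {c : ℝ≥0∞} {a : ℝ}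
    (ha0 : 0 < a) (ha : a ≤ 1) (h1 : ∀ j, ∑' i, r i j = 1) (h2 : ∀ i, ∑' j, r i j ≤ 1)
    (h3 : ∀ i, ∑' j, r i j * ν j ≤ c * ξ i) : ∑' j, ν j ^ a ≤ c ^ a * ∑' i, ξ i ^ a :=
  calc ∑' j, ν j ^ a = ∑' j, ∑' i, r i j * ν j ^ a := by
        simp only [ENNReal.tsum_mul_right, h1, one_mul]
    _ = ∑' i, ∑' j, r i j * ν j ^ a := ENNReal.tsum_comm
    _ ≤ ∑' i, (c * ξ i) ^ a := ENNReal.tsum_le_tsum fun i =>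
        (tsum_mul_rpow_le_of_le_one ha0 ha (h2 i)).trans (ENNReal.rpow_le_rpow (h3 i) ha0.le)
    _ = c ^ a * ∑' i, ξ i ^ a := by
        simp only [ENNReal.mul_rpow_of_nonneg _ _ ha0.le, ENNReal.tsum_mul_left]

end Jensen

/-! ### Traces of powers under conjugation -/

section Trace

variable {H : Type*} [NormedAddCommGroup H] [InnerProductSpace ℝ H]

lemma eigenvalue_nonneg {T : H →L[ℝ] H} (hT : T.IsPositive) {v : H} (hv : ‖v‖ = 1) {μ : ℝ}
    (h : T v = μ • v) : 0 ≤ μ := by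
  have h1 := hT.inner_nonneg_right v
  rwa [h, real_inner_smul_right, real_inner_self_eq_norm_sq, hv, one_pow, mul_one] at h1

lemma tsum_ofReal_inner_sq_le {ι : Type*} {g : ι → H} (hg : Orthonormal ℝ g) (x : H) :
    ∑' i, ENNReal.ofReal (⟪x, g i⟫_ℝ ^ 2) ≤ ENNReal.ofReal (‖x‖ ^ 2) := by
  rw [ENNReal.tsum_eq_iSup_sum]
  refine iSup_le fun s => ?_
  rw [← ENNReal.ofReal_sum_of_nonneg fun _ _ => sq_nonneg _]
  refine ENNReal.ofReal_le_ofReal ?_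
  have h := hg.sum_inner_products_le x (s := s)
  simpa only [Real.norm_eq_abs, sq_abs, real_inner_comm] using h

variable [CompleteSpace H]

/-- The trace of `T ^ a` is the sum of the `a`-th powers of the eigenvalues of `T`. -/
lemma trace_opPow_eq_tsum {T : H →L[ℝ] H} (hT : T.IsPositive) {a : ℝ} (ha : 0 ≤ a) {ι : Type*}
    (b : HilbertBasis ι ℝ H) {μ : ι → ℝ} (hb : ∀ i, T (b i) = μ i • b i) :
    trace (opPow T a) = ∑' i, ENNReal.ofReal (μ i) ^ a := by
  rw [trace_eq_tsum (isPositive_opPow hT ha) b]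
  refine tsum_congr fun i => ?_
  rw [opPow_apply_eigenvector hT ha (hb i), real_inner_smul_right, real_inner_self_eq_norm_sq,
    b.orthonormal.1 i, one_pow, mul_one, ENNReal.ofReal_rpow_of_nonneg
    (eigenvalue_nonneg hT (b.orthonormal.1 i) (hb i)) ha]

/-- `tr (K X K^*) ^ a ≤ ‖K‖ ^ (2 a) tr X ^ a` for positive `X`, if `X` and `K X K^*` are
diagonalizable. -/
lemma trace_opPow_conj_le {X N K : H →L[ℝ] H} (hX : X.IsPositive) (hN : N = K * X * star K)
    {ι κ : Type*} (b : HilbertBasis ι ℝ H) {ξ : ι → ℝ} (hb : ∀ i, X (b i) = ξ i • b i)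
    (e : HilbertBasis κ ℝ H) {ν : κ → ℝ} (he : ∀ j, N (e j) = ν j • e j) {c : ℝ} (hK : ‖K‖ ^ 2 ≤ c)
    {a : ℝ} (ha : 0 < a) :
    trace (opPow N a) ≤ ENNReal.ofReal c ^ a * trace (opPow X a) := by
  have hNp : N.IsPositive := by rw [hN]; exact hX.conj_adjoint K
  have hξ : ∀ i, 0 ≤ ξ i := fun i => eigenvalue_nonneg hX (b.orthonormal.1 i) (hb i)
  have hν : ∀ j, 0 ≤ ν j := fun j => eigenvalue_nonneg hNp (e.orthonormal.1 j) (he j)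
  rw [trace_opPow_eq_tsum hX ha.le b hb, trace_opPow_eq_tsum hNp ha.le e he]
  set S := opPow X (1 / 2) with hS
  have hSs : ∀ x y, ⟪S x, y⟫_ℝ = ⟪x, S y⟫_ℝ := (isSelfAdjoint_opPow X (1 / 2)).isSymmetric
  have hSS : ∀ x, S (S x) = X x := fun x => by
    change (S * S) x = X x
    rw [hS, opPow_mul_of_nonneg hX (by norm_num) (by norm_num), add_halves,
      opPow_one hX.isSelfAdjoint]
  have hSb : ∀ i, S (b i) = √(ξ i) • b i := fun i => by
    rw [Real.sqrt_eq_rpow]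
    exact opPow_apply_eigenvector hX (by norm_num) (hb i)
  have hK1 : ∀ x, ‖K x‖ ^ 2 ≤ c * ‖x‖ ^ 2 := fun x =>
    calc ‖K x‖ ^ 2 ≤ (‖K‖ * ‖x‖) ^ 2 := by gcongr; exact K.le_opNorm x
      _ = ‖K‖ ^ 2 * ‖x‖ ^ 2 := mul_pow _ _ _
      _ ≤ c * ‖x‖ ^ 2 := by gcongr
  have hK2 : ∀ x, ‖star K x‖ ^ 2 ≤ c * ‖x‖ ^ 2 := fun x =>
    calc ‖star K x‖ ^ 2 ≤ (‖star K‖ * ‖x‖) ^ 2 := by gcongr; exact (star K).le_opNorm x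
      _ = ‖K‖ ^ 2 * ‖x‖ ^ 2 := by
        rw [mul_pow]
        congr 2
        exact LinearIsometryEquiv.norm_map ContinuousLinearMap.adjoint K
      _ ≤ c * ‖x‖ ^ 2 := by gcongr
  have hc : 0 ≤ c := (sq_nonneg _).trans hK
  have hadj : ∀ x y, ⟪x, star K y⟫_ℝ = ⟪K x, y⟫_ℝ := fun x y =>
    ContinuousLinearMap.adjoint_inner_right K x y
  -- With `S = X^(1/2)`, the vectors `S K^* e_j` are orthogonal with squared norms `ν j`. Expanding
  -- these norms in the basis `b` ties `ν` to `ξ`.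
  have hgram : ∀ i j, ⟪S (star K (e i)), S (star K (e j))⟫_ℝ = ν j * ⟪e i, e j⟫_ℝ := by
    intro i j
    rw [hSs, hSS, real_inner_comm, hadj, real_inner_comm, ← real_inner_smul_right, ← he j, hN]
    rfl
  have hnorm : ∀ j, ‖S (star K (e j))‖ ^ 2 = ν j := fun j => by
    rw [← real_inner_self_eq_norm_sq, hgram, real_inner_self_eq_norm_sq, e.orthonormal.1 j]
    ring
  have hcoord : ∀ i y, ⟪b i, S y⟫_ℝ = √(ξ i) * ⟪b i, y⟫_ℝ := fun i y => by
    rw [← hSs, hSb, real_inner_smul_left]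
  rcases le_total 1 a with h1 | h1
  · refine tsum_rpow_le_of_one_le (q := fun i j => ENNReal.ofReal (⟪b i, star K (e j)⟫_ℝ ^ 2)) h1
      ?_ ?_ ?_
    · intro j
      rw [← hnorm, ofReal_norm_sq b]
      refine tsum_congr fun i => ?_
      rw [← ENNReal.ofReal_mul (sq_nonneg _), hcoord, mul_pow, Real.sq_sqrt (hξ i), mul_comm]
    · intro j
      rw [← ofReal_norm_sq b]
      refine ENNReal.ofReal_le_ofReal ((hK2 _).trans ?_)
      rw [e.orthonormal.1 j, one_pow, mul_one]
    · intro i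
      have h : ∀ j, ⟪b i, star K (e j)⟫_ℝ = ⟪e j, K (b i)⟫_ℝ := fun j => by
        rw [hadj, real_inner_comm]
      simp only [h]
      rw [← ofReal_norm_sq e]
      refine ENNReal.ofReal_le_ofReal ((hK1 _).trans ?_)
      rw [b.orthonormal.1 i, one_pow, mul_one]
  -- Null eigenvalues contribute nothing as `a > 0`; dropping them allows the normalization `g j = S
  -- K^* e_j / √(ν j)`.
  · have hsupp : Function.support (fun j => ENNReal.ofReal (ν j) ^ a) ⊆ {j | ν j ≠ 0} := by
      intro j hj h0
      apply hj
      simp [h0, ha]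
    rw [← tsum_subtype_eq_of_support_subset hsupp]
    set g : {j | ν j ≠ 0} → H := fun j => (√(ν j))⁻¹ • S (star K (e j)) with hg
    have hsq : ∀ j : {j | ν j ≠ 0}, (√(ν j)) ^ 2 = ν j := fun j => Real.sq_sqrt (hν j)
    have hpos : ∀ j : {j | ν j ≠ 0}, 0 < ν j := fun j => lt_of_le_of_ne (hν j) (Ne.symm j.2)
    have hgo : Orthonormal ℝ g := by
      constructor
      · intro j
        have h2 : ‖g j‖ ^ 2 = 1 := by
          rw [hg, norm_smul, mul_pow, hnorm, norm_inv, inv_pow, Real.norm_eq_abs, sq_abs, hsq]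
          exact inv_mul_cancel₀ j.2
        exact (pow_eq_one_iff_of_nonneg (norm_nonneg _) two_ne_zero).mp h2
      · intro i j hij
        change ⟪g i, g j⟫_ℝ = 0
        rw [hg, real_inner_smul_left, real_inner_smul_right, hgram,
          e.orthonormal.2 (fun h => hij (Subtype.ext h))]
        ring
    refine tsum_rpow_le_of_le_one (r := fun i j => ENNReal.ofReal (⟪b i, g j⟫_ℝ ^ 2))
      (ν := fun j : {j | ν j ≠ 0} => ENNReal.ofReal (ν j)) ha h1 ?_ ?_ ?_
    · intro j
      rw [← ofReal_norm_sq b, hgo.1 j]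
      simp
    · intro i
      refine (tsum_ofReal_inner_sq_le hgo (b i)).trans ?_
      rw [b.orthonormal.1 i]
      simp
    -- Here `∑ j, ⟪b i, g j⟫² ν j = ∑ j, ⟪K S b_i, e j⟫²`, at most `‖K S b_i‖² ≤ c ξ i` by Bessel.
    · intro i
      have h : ∀ j : {j | ν j ≠ 0}, ENNReal.ofReal (⟪b i, g j⟫_ℝ ^ 2) * ENNReal.ofReal (ν j)
          = ENNReal.ofReal (⟪K (S (b i)), e j⟫_ℝ ^ 2) := by
        intro j
        rw [← ENNReal.ofReal_mul (sq_nonneg _), hg, real_inner_smul_right, ← hSs, hadj, mul_pow,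
          inv_pow, hsq, mul_comm, ← mul_assoc, mul_inv_cancel₀ j.2, one_mul]
      simp only [h]
      refine (tsum_ofReal_inner_sq_le (g := fun j : {j | ν j ≠ 0} => e j)
        (e.orthonormal.comp _ Subtype.val_injective) _).trans ?_
      rw [← ENNReal.ofReal_mul hc]
      refine ENNReal.ofReal_le_ofReal ((hK1 _).trans ?_)
      rw [hSb, norm_smul, b.orthonormal.1 i, mul_one, Real.norm_eq_abs, sq_abs,
        Real.sq_sqrt (hξ i)]

end Trace

/-! ### From operator domination to the Rényi bound -/

section Renyi

variable {H : Type*} [NormedAddCommGroup H] [InnerProductSpace ℝ H] [CompleteSpace H]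

/-- With `t = (α - 1) / (2α)` one has `t + 1/α + t = 1`, so `A` splits as `A^t A^(1/α) A^t`. The
double `star` matches the form `K * X * star K` of `trace_opPow_conj_le`. -/
lemma opPow_conj_eq_of_one_lt {A B : H →L[ℝ] H} (hA : A.IsPositive) {α : ℝ} (hα : 1 < α) :
    opPow B ((1 - α) / (2 * α)) * A * opPow B ((1 - α) / (2 * α))
      = star (opPow A ((α - 1) / (2 * α)) * opPow B (-((α - 1) / (2 * α)))) * opPow A α⁻¹ *
        star (star (opPow A ((α - 1) / (2 * α)) * opPow B (-((α - 1) / (2 * α))))) := by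
  have hα0 : 0 < α := by linarith
  have ht : 0 ≤ (α - 1) / (2 * α) := div_nonneg (by linarith) (by linarith)
  have e : (1 - α) / (2 * α) = -((α - 1) / (2 * α)) := by ring
  rw [star_star, star_mul, (isSelfAdjoint_opPow A _).star_eq, (isSelfAdjoint_opPow B _).star_eq, e]
  have hA1 : A = opPow A ((α - 1) / (2 * α)) * opPow A α⁻¹ * opPow A ((α - 1) / (2 * α)) := by
    rw [opPow_mul_of_nonneg hA ht (by positivity), opPow_mul_of_nonneg hA (by positivity) ht]
    conv_lhs => rw [← opPow_one hA.isSelfAdjoint]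
    congr 1
    field_simp
    ring
  conv_lhs => enter [1, 2]; rw [hA1]
  simp only [mul_assoc]

/-- With `s = (1 - α) / (2α)` one has `2 s + 1 = 1/α`; inserting `B^(-s) B^s = 1` on both sides of
`A` in `A^s A A^s` exposes the sandwiched operator. -/
lemma opPow_inv_eq_of_lt_one {A B : H →L[ℝ] H} (hA : A.IsPositive)
    (hB : ∀ x ∈ spectrum ℝ B, 0 < x) (hBs : IsSelfAdjoint B) {α : ℝ} (hα0 : 0 < α) (hα : α < 1) :
    opPow A α⁻¹ = (opPow A ((1 - α) / (2 * α)) * opPow B (-((1 - α) / (2 * α)))) *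
        (opPow B ((1 - α) / (2 * α)) * A * opPow B ((1 - α) / (2 * α))) *
        star (opPow A ((1 - α) / (2 * α)) * opPow B (-((1 - α) / (2 * α)))) := by
  have hs : 0 ≤ (1 - α) / (2 * α) := div_nonneg (by linarith) (by linarith)
  set s := (1 - α) / (2 * α) with hsd
  rw [star_mul, (isSelfAdjoint_opPow A _).star_eq, (isSelfAdjoint_opPow B _).star_eq]
  have h1 : opPow B (-s) * opPow B s = 1 := by
    rw [opPow_mul_of_pos hB, neg_add_cancel, opPow_zero hBs]
  have h2 : opPow B s * opPow B (-s) = 1 := by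
    rw [opPow_mul_of_pos hB, add_neg_cancel, opPow_zero hBs]
  calc opPow A α⁻¹ = opPow A s * A * opPow A s := by
        conv_rhs => enter [1, 2]; rw [← opPow_one hA.isSelfAdjoint]
        rw [opPow_mul_of_nonneg hA hs zero_le_one, opPow_mul_of_nonneg hA (by positivity) hs]
        congr 1
        rw [hsd]
        field_simp
        ring
    _ = opPow A s * (opPow B (-s) * opPow B s) * A * (opPow B s * opPow B (-s)) * opPow A s := by
        rw [h1, h2, mul_one, mul_one]
    _ = _ := by simp only [mul_assoc]

lemma opPow_inv_opPow {T : H →L[ℝ] H} (hT : T.IsPositive) {s : ℝ} (hs : 0 < s) :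
    opPow (opPow T s⁻¹) s = T := by
  rw [opPow, opPow, ← cfc_comp (fun x : ℝ => x ^ s) (fun x : ℝ => x ^ s⁻¹) T hT.isSelfAdjoint
    (continuousOn_rpow_of_nonneg _ hs.le) (continuousOn_rpow_of_nonneg _ (inv_nonneg.mpr hs.le))]
  conv_rhs => rw [← cfc_id' ℝ T hT.isSelfAdjoint]
  refine cfc_congr fun x hx => ?_
  change (x ^ s⁻¹) ^ s = x
  rw [← Real.rpow_mul (spectrum_nonneg hT hx), inv_mul_cancel₀ hs.ne', Real.rpow_one]

lemma inv_mul_log_le_of_one_lt {x : ℝ≥0∞} {α ε : ℝ} (hα : 1 < α)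
    (hx : x ≤ ENNReal.ofReal (Real.exp (ε * (α - 1)))) :
    (((α - 1)⁻¹ : ℝ) : EReal) * ENNReal.log x ≤ (ε : EReal) := by
  have h0 : 0 < α - 1 := by linarith
  have h1 : ENNReal.log x ≤ ((ε * (α - 1) : ℝ) : EReal) := by
    refine (ENNReal.log_le_log hx).trans_eq ?_
    rw [ENNReal.log_ofReal_of_pos (Real.exp_pos _), Real.log_exp]
  calc (((α - 1)⁻¹ : ℝ) : EReal) * ENNReal.log x
      ≤ (((α - 1)⁻¹ : ℝ) : EReal) * ((ε * (α - 1) : ℝ) : EReal) :=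
        mul_le_mul_of_nonneg_left h1 (by exact_mod_cast (inv_pos.mpr h0).le)
    _ = (ε : EReal) := by
        rw [← EReal.coe_mul]
        congr 1
        field_simp

lemma inv_mul_log_le_of_lt_one {x : ℝ≥0∞} {α ε : ℝ} (hα : α < 1)
    (hx : ENNReal.ofReal (Real.exp (ε * (α - 1))) ≤ x) :
    (((α - 1)⁻¹ : ℝ) : EReal) * ENNReal.log x ≤ (ε : EReal) := by
  have h0 : 0 < 1 - α := by linarith
  have h1 : ((ε * (α - 1) : ℝ) : EReal) ≤ ENNReal.log x := by
    refine le_trans (le_of_eq ?_) (ENNReal.log_le_log hx)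
    rw [ENNReal.log_ofReal_of_pos (Real.exp_pos _), Real.log_exp]
  have e : (α - 1)⁻¹ = -(1 - α)⁻¹ := by rw [← inv_neg, neg_sub]
  rw [e, EReal.coe_neg, EReal.neg_mul]
  have h2 : (((1 - α)⁻¹ : ℝ) : EReal) * ((ε * (α - 1) : ℝ) : EReal) ≤
      (((1 - α)⁻¹ : ℝ) : EReal) * ENNReal.log x :=
    mul_le_mul_of_nonneg_left h1 (by exact_mod_cast (inv_pos.mpr h0).le)
  refine (EReal.neg_le_neg_iff.mpr h2).trans_eq ?_
  rw [← EReal.coe_mul, ← EReal.coe_neg]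
  congr 1
  field_simp
  ring

/-- If `A ≤ exp ε • B`, then the order-`α` Rényi divergence of `A` and `B` is at most `ε`. -/
lemma quantumRenyi_le {A B : H →L[ℝ] H} (hA : A.IsPositive) (hAc : IsCompactOperator A)
    (hA1 : trace A = 1) (hB : IsSelfAdjoint B) {lam ε α : ℝ} (hlam : 0 < lam)
    (hBs : ∀ x ∈ spectrum ℝ B, lam ≤ x)
    (hAB : ∀ x, ⟪A x, x⟫_ℝ ≤ Real.exp ε * ⟪B x, x⟫_ℝ)
    (hα : α ∈ Set.Ico (1 / 2 : ℝ) 1 ∪ Set.Ioi (1 : ℝ)) : quantumRenyi α A B ≤ (ε : EReal) := by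
  have hBp : ∀ x ∈ spectrum ℝ B, 0 < x := fun x hx => hlam.trans_le (hBs x hx)
  have hnorm : ∀ t ∈ Set.Icc (0 : ℝ) (1 / 2),
      ‖opPow A t * opPow B (-t)‖ ^ 2 ≤ Real.exp (ε * (2 * t)) := fun t ht => by
    have h := norm_opPow_mul_opPow_neg_le hA hB hlam hBs (Real.exp_pos ε) hAB ht
    calc ‖opPow A t * opPow B (-t)‖ ^ 2 ≤ (Real.exp ε ^ t) ^ 2 := by gcongr
      _ = Real.exp (ε * (2 * t)) := by
        rw [← Real.exp_mul, ← Real.exp_nat_mul]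
        congr 1
        push_cast
        ring
  have hα0 : 0 < α := by
    rcases hα with h | h
    · linarith [h.1]
    · exact zero_lt_one.trans h
  have hexp : ∀ y : ℝ, ENNReal.ofReal (Real.exp y) ^ α = ENNReal.ofReal (Real.exp (y * α)) :=
    fun y => by rw [ENNReal.ofReal_rpow_of_pos (Real.exp_pos _), Real.exp_mul]
  set s := (1 - α) / (2 * α) with hs
  set X := opPow B s * A * opPow B s with hX
  have hXp : X.IsPositive := isPositive_conj hA (isSelfAdjoint_opPow B s)
  have hXc : IsCompactOperator X := (hAc.clm_comp (opPow B s)).comp_clm (opPow B s)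
  obtain ⟨ι, b, ξ, hb⟩ := exists_eigenbasis hXc hXp.isSelfAdjoint
  obtain ⟨κ, e, ν, he⟩ := exists_eigenbasis hAc hA.isSelfAdjoint
  have hinv : 0 ≤ α⁻¹ := by positivity
  have he' : ∀ j, opPow A α⁻¹ (e j) = ν j ^ α⁻¹ • e j := fun j =>
    opPow_apply_eigenvector hA hinv (he j)
  rw [quantumRenyi, hA1, div_one]
  rcases hα with h | h
  · refine inv_mul_log_le_of_lt_one h.2 ?_
    -- The upper bound is where `α ≥ 1/2` is needed.
    have hs0 : s ∈ Set.Icc (0 : ℝ) (1 / 2) := by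
      refine ⟨div_nonneg (by linarith [h.2]) (by linarith), ?_⟩
      rw [hs, div_le_iff₀ (by linarith)]
      linarith [h.1]
    have hle := trace_opPow_conj_le hXp (opPow_inv_eq_of_lt_one hA hBp hB hα0 h.2) b hb e he'
      (hnorm s hs0) hα0
    rw [opPow_inv_opPow hA hα0, hA1, hexp] at hle
    have e2 : ε * (2 * s) * α = ε * (1 - α) := by
      rw [hs]
      field_simp
    rw [e2] at hle
    calc ENNReal.ofReal (Real.exp (ε * (α - 1)))
        = ENNReal.ofReal (Real.exp (ε * (α - 1))) * 1 := (mul_one _).symm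
      _ ≤ ENNReal.ofReal (Real.exp (ε * (α - 1))) *
          (ENNReal.ofReal (Real.exp (ε * (1 - α))) * trace (opPow X α)) := by gcongr
      _ = trace (opPow X α) := by
        rw [← mul_assoc, ← ENNReal.ofReal_mul (Real.exp_pos _).le, ← Real.exp_add,
          show ε * (α - 1) + ε * (1 - α) = 0 by ring, Real.exp_zero, ENNReal.ofReal_one, one_mul]
  · have h1 : 1 < α := h
    refine inv_mul_log_le_of_one_lt h1 ?_
    have ht0 : (α - 1) / (2 * α) ∈ Set.Icc (0 : ℝ) (1 / 2) := by
      refine ⟨div_nonneg (by linarith) (by linarith), ?_⟩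
      rw [div_le_iff₀ (by linarith)]
      linarith
    have hst : ‖star (opPow A ((α - 1) / (2 * α)) * opPow B (-((α - 1) / (2 * α))))‖ ^ 2
        ≤ Real.exp (ε * (2 * ((α - 1) / (2 * α)))) := by
      refine le_trans (le_of_eq ?_) (hnorm _ ht0)
      congr 1
      exact LinearIsometryEquiv.norm_map ContinuousLinearMap.adjoint _
    have hle := trace_opPow_conj_le (isPositive_opPow hA hinv) (opPow_conj_eq_of_one_lt hA h1)
      e he' b hb hst hα0
    rw [opPow_inv_opPow hA hα0, hA1, mul_one, hexp] at hle
    refine hle.trans_eq ?_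
    congr 2
    field_simp

end Renyi

/-! ### Feature maps and covariance operators -/

section Covariance

/-- Distinct basis vectors are `√2` apart, so balls of radius `1/2` around them are disjoint. -/
lemma countable_of_hilbertBasis {H ι : Type*} [NormedAddCommGroup H] [InnerProductSpace ℝ H]
    [TopologicalSpace.SeparableSpace H] (b : HilbertBasis ι ℝ H) : Countable ι := by
  refine Pairwise.countable_of_isOpen_disjoint (s := fun i => Metric.ball (b i) (1 / 2)) ?_
    (fun _ => Metric.isOpen_ball) (fun i => ⟨b i, Metric.mem_ball_self (by norm_num)⟩)
  intro i j hij
  refine Metric.ball_disjoint_ball ?_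
  have h1 : ‖b i - b j‖ ^ 2 = 2 := by
    rw [norm_sub_sq_real, b.orthonormal.1 i, b.orthonormal.1 j, b.orthonormal.2 hij]
    norm_num
  rw [dist_eq_norm]
  nlinarith [norm_nonneg (b i - b j)]

variable {X : Type*} {H : Type*} [NormedAddCommGroup H] [InnerProductSpace ℝ H] [CompleteSpace H]
  [RKHS ℝ H X ℝ] {k : X → X → ℝ}

lemma inner_featureMap (hH : HasKernel H k) (x y : X) :
    ⟪featureMap H x, featureMap H y⟫_ℝ = k x y := by
  rw [featureMap, featureMap, RKHS.kerFun_inner, RKHS.kerFun_apply, hH]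
  simp

variable [TopologicalSpace X]

lemma norm_featureMap (hk : IsNormalizedKernel k) (hH : HasKernel H k) (x : X) :
    ‖featureMap H x‖ = 1 := by
  have h : ‖featureMap H x‖ ^ 2 = 1 := by
    rw [← real_inner_self_eq_norm_sq, inner_featureMap hH, hk.diag_eq_one]
  exact (pow_eq_one_iff_of_nonneg (norm_nonneg _) two_ne_zero).mp h

lemma continuous_featureMap (hk : IsNormalizedKernel k) (hH : HasKernel H k) :
    Continuous (featureMap H : X → H) := by
  rw [continuous_iff_continuousAt]
  intro x
  rw [ContinuousAt, tendsto_iff_norm_sub_tendsto_zero]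
  -- The feature distance depends only on the kernel, so continuity of `k` suffices.
  have h : ∀ y, ‖featureMap H y - featureMap H x‖ = √(2 - 2 * k y x) := fun y => by
    rw [← Real.sqrt_sq (norm_nonneg (featureMap H y - featureMap H x)), norm_sub_sq_real,
      norm_featureMap hk hH, norm_featureMap hk hH, inner_featureMap hH]
    congr 1
    ring
  simp only [h]
  have hc : Continuous fun y => √(2 - 2 * k y x) := by
    have : Continuous fun y => k y x := hk.continuous.comp (by fun_prop : Continuous fun y => (y, x))
    fun_prop
  have := hc.tendsto x
  rwa [hk.diag_eq_one, mul_one, sub_self, Real.sqrt_zero] at this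

/-- The features span a dense subspace and form a continuous image of a separable space.
Separability makes bases countable, as needed in `trace_covariance`. -/
lemma separableSpace_of_hasKernel [TopologicalSpace.SeparableSpace X] (hk : IsNormalizedKernel k)
    (hH : HasKernel H k) : TopologicalSpace.SeparableSpace H := by
  rw [← TopologicalSpace.isSeparable_univ_iff]
  have h1 := (TopologicalSpace.isSeparable_range (continuous_featureMap (H := H) hk hH)).span (R := ℝ)
  refine h1.closure.mono fun x _ => ?_
  have h2 : x ∈ (Submodule.span ℝ {f | ∃ x v, RKHS.kerFun H x v = f}).topologicalClosure := by
    rw [RKHS.kerFun_dense]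
    trivial
  refine closure_mono ?_ h2
  refine SetLike.coe_subset_coe.mpr (Submodule.span_le.mpr ?_)
  rintro _ ⟨x, v, rfl⟩
  have : RKHS.kerFun H x v = v • featureMap H x := by
    rw [featureMap, ← map_smul, smul_eq_mul, mul_one]
  rw [this]
  exact Submodule.smul_mem _ _ (Submodule.subset_span ⟨x, rfl⟩)

variable [MeasurableSpace X] [OpensMeasurableSpace X]

lemma integrable_inner_featureMap_sq (hk : IsNormalizedKernel k) (hH : HasKernel H k)
    (p : Measure X) [IsFiniteMeasure p] (f : H) :
    Integrable (fun x => ⟪f, featureMap H x⟫_ℝ ^ 2) p := by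
  have hc := continuous_featureMap (H := H) hk hH
  refine Integrable.of_bound (C := ‖f‖ ^ 2) (Continuous.aestronglyMeasurable (by fun_prop))
    (Filter.Eventually.of_forall fun x => ?_)
  rw [norm_pow]
  gcongr
  refine (norm_inner_le_norm _ _).trans_eq ?_
  rw [norm_featureMap hk hH, mul_one]

variable [SecondCountableTopology X]

lemma integrable_rankOne (hk : IsNormalizedKernel k) (hH : HasKernel H k) (p : Measure X)
    [IsFiniteMeasure p] :
    Integrable (fun x => InnerProductSpace.rankOne ℝ (featureMap H x) (featureMap H x)) p := by
  have hc := continuous_featureMap (H := H) hk hH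
  have : SecondCountableTopologyEither X (H →L[ℝ] H) := ⟨Or.inl inferInstance⟩
  have hm : Continuous fun x =>
      InnerProductSpace.rankOne ℝ (featureMap H x) (featureMap H x) :=
    ((InnerProductSpace.rankOne ℝ).continuous.comp hc).clm_apply hc
  refine Integrable.of_bound (C := 1) hm.aestronglyMeasurable
    (Filter.Eventually.of_forall fun x => ?_)
  rw [InnerProductSpace.norm_rankOne, norm_featureMap hk hH, mul_one]

lemma inner_covariance (hk : IsNormalizedKernel k) (hH : HasKernel H k) (p : Measure X)
    [IsFiniteMeasure p] (f g : H) :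
    ⟪f, covariance H p g⟫_ℝ = ∫ x, ⟪f, featureMap H x⟫_ℝ * ⟪g, featureMap H x⟫_ℝ ∂p := by
  have hi := integrable_rankOne (H := H) hk hH p
  rw [covariance, ContinuousLinearMap.integral_apply hi,
    ← integral_inner (hi.apply_continuousLinearMap g)]
  refine integral_congr_ae (Filter.Eventually.of_forall fun x => ?_)
  simp only
  rw [InnerProductSpace.rankOne_apply, real_inner_smul_right, mul_comm, real_inner_comm g]

lemma isPositive_covariance (hk : IsNormalizedKernel k) (hH : HasKernel H k) (p : Measure X)
    [IsFiniteMeasure p] : (covariance H p).IsPositive := by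
  refine ⟨fun f g => ?_, fun f => ?_⟩
  · change ⟪covariance H p f, g⟫_ℝ = ⟪f, covariance H p g⟫_ℝ
    rw [real_inner_comm, inner_covariance hk hH, inner_covariance hk hH]
    simp only [mul_comm]
  · change 0 ≤ ⟪covariance H p f, f⟫_ℝ
    rw [real_inner_comm, inner_covariance hk hH]
    exact integral_nonneg fun x => mul_self_nonneg _

/-- An average of rank-one operators stays in the closed convex set of compact operators. -/
lemma isCompactOperator_covariance (hk : IsNormalizedKernel k) (hH : HasKernel H k)
    (p : Measure X) [IsProbabilityMeasure p] : IsCompactOperator (covariance H p) := by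
  have hconv : Convex ℝ {T : H →L[ℝ] H | IsCompactOperator T} :=
    (compactOperator (RingHom.id ℝ) H H).convex
  refine hconv.integral_mem isClosed_setOfPred_isCompactOperator
    (Filter.Eventually.of_forall fun x => ?_) (integrable_rankOne hk hH p)
  have h : IsCompactOperator (ContinuousLinearMap.toSpanSingleton ℝ (featureMap H x)) :=
    isCompactOperator_of_locallyCompactSpace_rng _
  exact h.comp_clm (innerSL ℝ (featureMap H x))

/-- Exchanging the countable sum with the integral leaves `∫ ‖φ x‖² dp = 1`, by Parseval. -/
lemma trace_covariance (hk : IsNormalizedKernel k) (hH : HasKernel H k) (p : Measure X)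
    [IsProbabilityMeasure p] : trace (covariance H p) = 1 := by
  have := separableSpace_of_hasKernel (H := H) hk hH
  have hcount := countable_of_hilbertBasis (basis H)
  have h : ∀ i, ENNReal.ofReal ⟪basis H i, covariance H p (basis H i)⟫_ℝ
      = ∫⁻ x, ENNReal.ofReal (⟪basis H i, featureMap H x⟫_ℝ ^ 2) ∂p := fun i => by
    rw [inner_covariance hk hH]
    simp only [← sq]
    exact ofReal_integral_eq_lintegral_ofReal (integrable_inner_featureMap_sq hk hH p _)
      (Filter.Eventually.of_forall fun _ => sq_nonneg _)
  simp only [trace, h]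
  rw [← lintegral_tsum fun i =>
    (integrable_inner_featureMap_sq hk hH p _).aemeasurable.ennreal_ofReal]
  simp only [← ofReal_norm_sq, norm_featureMap hk hH]
  simp

end Covariance

/-! ### From events to bounded functions, and the conclusion -/

section Privacy

variable {X : Type*} [MeasurableSpace X]

/-- An `(ε, δ)`-bound for events extends to bounded nonnegative functions. -/
lemma integral_le_of_forall_real_le {p q : Measure X} [IsFiniteMeasure p] [IsFiniteMeasure q]
    {c δ : ℝ} (h : ∀ S : Set X, MeasurableSet S → p.real S ≤ c * q.real S + δ) {u : X → ℝ}
    (hu : Measurable u) {M : ℝ} (hM : 0 ≤ M) (hu0 : ∀ x, 0 ≤ u x) (huM : ∀ x, u x ≤ M) :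
    ∫ x, u x ∂p ≤ c * ∫ x, u x ∂q + δ * M := by
  have hint : ∀ (m : Measure X) [IsFiniteMeasure m], Integrable u m := fun m _ =>
    Integrable.of_bound (C := M) hu.aestronglyMeasurable (Filter.Eventually.of_forall fun x => by
      rw [Real.norm_of_nonneg (hu0 x)]; exact huM x)
  -- Layer cake: the event bound is used at each level `t ∈ (0, M]`, so the additive `δ` integrates
  -- to `δ * M`.
  have hlayer : ∀ (m : Measure X) [IsFiniteMeasure m],
      ∫ x, u x ∂m = ∫ t in Set.Ioc 0 M, m.real {x | t ≤ u x} := fun m _ =>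
    (hint m).integral_eq_integral_Ioc_meas_le (Filter.Eventually.of_forall hu0)
      (Filter.Eventually.of_forall huM)
  have hanti : ∀ (m : Measure X) [IsFiniteMeasure m],
      IntegrableOn (fun t => m.real {x | t ≤ u x}) (Set.Ioc 0 M) := fun m _ => by
    have : Antitone fun t => m.real {x | t ≤ u x} := fun s t hst =>
      measureReal_mono fun x (hx : t ≤ u x) => hst.trans hx
    exact (this.intervalIntegrable (a := 0) (b := M)).1
  have hconst : IntegrableOn (fun _ : ℝ => δ) (Set.Ioc 0 M) := integrableOn_const (by simp)
  rw [hlayer p, hlayer q]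
  calc ∫ t in Set.Ioc 0 M, p.real {x | t ≤ u x}
      ≤ ∫ t in Set.Ioc 0 M, (c * q.real {x | t ≤ u x} + δ) :=
        setIntegral_mono (hanti p) (((hanti q).const_mul c).add hconst)
          fun t => h _ (measurableSet_le measurable_const hu)
    _ = c * (∫ t in Set.Ioc 0 M, q.real {x | t ≤ u x}) + δ * M := by
        rw [integral_add ((hanti q).const_mul c) hconst, integral_const_mul, setIntegral_const]
        simp [hM, mul_comm]

end Privacy

end KernelRenyi

theorem mainTheorem2 {d : ℕ} (X : Set (EuclideanSpace ℝ (Fin d)))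
    (k : X → X → ℝ) (hk : KernelRenyi.IsNormalizedKernel k)
    (H : Type*) [NormedAddCommGroup H] [InnerProductSpace ℝ H] [CompleteSpace H] [RKHS ℝ H X ℝ]
    (hH : KernelRenyi.HasKernel H k)
    {𝒟 : Type*} (adj : 𝒟 → 𝒟 → Prop) (law : 𝒟 → ProbabilityMeasure X)
    (ε δ α : ℝ) (hε : 0 < ε) (hδ : 0 < δ) (hα : α ∈ Set.Ico (1 / 2 : ℝ) 1 ∪ Set.Ioi (1 : ℝ))
    (hDP : KernelRenyi.IsDP ε δ adj law) :
    KernelRenyi.IsRKRDP H α (δ * Real.exp (-ε)) ε adj law := by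
  intro D D' hadj
  set p : Measure X := (law D : Measure X)
  set q : Measure X := (law D' : Measure X)
  have hlam : 0 < δ * Real.exp (-ε) := by positivity
  have hq := KernelRenyi.isPositive_covariance (H := H) hk hH q
  have hB : IsSelfAdjoint (KernelRenyi.covariance H q +
      (δ * Real.exp (-ε)) • ContinuousLinearMap.id ℝ H) :=
    hq.isSelfAdjoint.add ((IsSelfAdjoint.all _).smul (IsSelfAdjoint.one (H →L[ℝ] H)))
  refine KernelRenyi.quantumRenyi_le (KernelRenyi.isPositive_covariance hk hH p)
    (KernelRenyi.isCompactOperator_covariance hk hH p) (KernelRenyi.trace_covariance hk hH p) hB hlam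
    (fun x hx => KernelRenyi.le_of_mem_spectrum_add_smul hq hx) (fun f => ?_) hα
  have hc := KernelRenyi.continuous_featureMap (H := H) hk hH
  have hexp : Real.exp ε * Real.exp (-ε) = 1 := by
    rw [← Real.exp_add, add_neg_cancel, Real.exp_zero]
  rw [_root_.add_apply, inner_add_left, _root_.smul_apply, ContinuousLinearMap.id_apply,
    real_inner_smul_left, real_inner_self_eq_norm_sq, real_inner_comm,
    KernelRenyi.inner_covariance hk hH, real_inner_comm, KernelRenyi.inner_covariance hk hH]
  -- The test function is `⟪f, φ x⟫²`, bounded by `M = ‖f‖²` because features are unit vectors.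
  refine (KernelRenyi.integral_le_of_forall_real_le (hDP D D' hadj)
    (Continuous.measurable (by fun_prop)) (sq_nonneg ‖f‖) (fun x => mul_self_nonneg _)
    fun x => ?_).trans_eq ?_
  · rw [← sq, ← sq_abs]
    gcongr
    refine (abs_real_inner_le_norm _ _).trans_eq ?_
    rw [KernelRenyi.norm_featureMap hk hH, mul_one]
  -- The choice `lam = δ e^(-ε)` makes `e^ε * lam * ‖f‖²` equal to the additive term `δ ‖f‖²`.
  · linear_combination (-δ * ‖f‖ ^ 2) * hexp
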